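/- Let $d\ge 1$ and write points of $\mathbb{R}^d$ as $x=(x_1,\xi)$ with $x_1\in\mathbb{R}$, $\xi\in\mathbb{R}^{d-1}$; $|\cdot|$ is the Euclidean norm. Let $L>0$, let $U\subset\mathbb{R}^d$ be an open set containing $(-L,+\infty)\times\mathbb{R}^{d-1}$, and let $\mathbf{a}\in C^1(U;\mathbb{R}^d)$ be globally Lipschitz continuous on $U$ with Lipschitz constant $P>0$. Suppose that there are constants $\alpha,\beta$ with $$0<\alpha\le \mathbf{a}_1(0,\xi),\qquad |\mathbf{a}(0,\xi)|\le\beta\qquad\text{for all }\xi\in\mathbb{R}^{d-1}.$$ For $\xi\in\mathbb{R}^{d-1}$ consider the problem $$x_\xi'(s)=\mathbf{a}(x_\xi(s)),\qquad x_\xi(0)=(0,\xi),\qquad(\ast)$$ for $U$-valued solutions on open intervals containing $0$; a solution is maximal if it has no extension to a solution on a strictly larger open interval. Then: (i) For every $\xi\in\mathbb{R}^{d-1}$, problem $(\ast)$ has a unique maximal solution $x_\xi$, defined on an interval $(T_{\min}(\xi),T_{\max}(\xi))$ with $-\infty\le T_{\min}(\xi)<0$ and $T_{\max}(\xi)=+\infty$,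 and $x_\xi$ is $C^1$ on $(T_{\min}(\xi),+\infty)$. The set $\Omega=\{(s,\xi):\xi\in\mathbb{R}^{d-1},\ T_{\min}(\xi)<s<T_{\max}(\xi)\}$ is open, and the flow $\Phi:\Omega\to\mathbb{R}^d$, $\Phi(s,\xi)=x_\xi(s)$, is $C^1$ on $\Omega$. (ii) If $\xi\ne\eta$, the curves $x_\xi$ and $x_\eta$ do not intersect: $x_\xi(s)\neq x_\eta(t)$ for all $s\in(T_{\min}(\xi),+\infty)$ and $t\in(T_{\min}(\eta),+\infty)$. (iii) Let $\ell=\frac1P\ln\left(1+\frac{LP}{\beta}\right)>0$ and $\Omega_\ell=(-\ell,+\infty)\times\mathbb{R}^{d-1}$. Then $\Omega_\ell\subset\Omega$, $\Phi(\Omega_\ell)\subset U$, and $\Phi$ is a $C^1$-diffeomorphism from $\Omega_\ell$ onto its image $\Phi(\Omega_\ell)$, which is open. (iv) If moreover $\mathbf{a}_1(x)\ge\alpha$ for all $x\in U$, then there exists $\delta>0$ such that $(-\delta,+\infty)\times\mathbb{R}^{d-1}\subset\Phi(\Omega_\ell)$. -/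

import Mathlib

open scoped NNReal

noncomputable section

namespace CharFlow

/-- Euclidean space `ℝ^k` (with the Euclidean norm). -/
abbrev E (k : ℕ) := EuclideanSpace ℝ (Fin k)

/-- The point `(x₁, ξ)` of `ℝ^d`, `d = n + 1`, with `x₁ ∈ ℝ` and `ξ ∈ ℝ^(d-1)`. -/
def point {n : ℕ} (x₁ : ℝ) (ξ : E n) : E (n + 1) :=
  WithLp.toLp 2 (Fin.cons x₁ (fun i => ξ i))

/-- The strip `(-r, +∞) × ℝ^(d-1)` in `ℝ^d`, `d = n + 1`; coordinate `0` is `x₁`. -/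
def strip (n : ℕ) (r : ℝ) : Set (E (n + 1)) := {x | -r < x 0}

/-- The open interval `(S, T)` of real times with possibly infinite endpoints. -/
def timeInterval (S T : EReal) : Set ℝ := {t | S < (t : EReal) ∧ (t : EReal) < T}

/-- `x` is, on the open interval `(S, T) ∋ 0`, a solution with values in `U` of
`x' = a(x)`, `x(0) = x₀`. The values of `x` outside `(S, T)` are irrelevant. -/
structure IsSolution {k : ℕ} (U : Set (E k)) (a : E k → E k) (x₀ : E k)
    (S T : EReal) (x : ℝ → E k) : Prop where
  left_neg : S < 0
  right_pos : 0 < T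
  initial : x 0 = x₀
  mem : ∀ t ∈ timeInterval S T, x t ∈ U
  hasDerivAt : ∀ t ∈ timeInterval S T, HasDerivAt x (a (x t)) t

/-- A maximal solution: a solution that no solution on a larger open interval extends. -/
structure IsMaximalSolution {k : ℕ} (U : Set (E k)) (a : E k → E k) (x₀ : E k)
    (S T : EReal) (x : ℝ → E k) : Prop where
  isSolution : IsSolution U a x₀ S T x
  maximal : ∀ (S' T' : EReal) (y : ℝ → E k), IsSolution U a x₀ S' T' y →
    S' ≤ S → T ≤ T' → Set.EqOn y x (timeInterval S T) → S' = S ∧ T' = T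

/-- The domain `Ω = {(s, ξ) : T_min(ξ) < s < T_max(ξ)}` of the flow. -/
def flowDomain {n : ℕ} (Tmin Tmax : E n → EReal) : Set (ℝ × E n) :=
  {p | p.1 ∈ timeInterval (Tmin p.2) (Tmax p.2)}

/-- The flow `Φ(s, ξ) = x_ξ(s)` (meaningful on `flowDomain`). -/
def flow {n : ℕ} (x : E n → ℝ → E (n + 1)) (p : ℝ × E n) : E (n + 1) := x p.2 p.1

/-- The domain `Ω_ℓ = (-ℓ, +∞) × ℝ^(d-1)`. -/
def flowStrip (n : ℕ) (l : ℝ) : Set (ℝ × E n) := {p | -l < p.1}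

/-- `f` is a `C¹`-diffeomorphism from the open set `s` onto its (open) image `f(s)`. -/
structure IsC1DiffeoOn {F G : Type*} [NormedAddCommGroup F] [NormedSpace ℝ F]
    [NormedAddCommGroup G] [NormedSpace ℝ G] (f : F → G) (s : Set F) : Prop where
  isOpen_source : IsOpen s
  isOpen_image : IsOpen (f '' s)
  contDiffOn : ContDiffOn ℝ 1 f s
  exists_inverse : ∃ g : G → F, ContDiffOn ℝ 1 g (f '' s) ∧ Set.LeftInvOn g f s

end CharFlow

end

/-!
The vector field `a` is Lipschitz on `U`, so it extends to a vector field `b` that is Lipschitz on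
the whole space, and `b` has a flow `φ` defined for all times (`exists_global_solution`,
`exists_isGlobalFlow`). The maximal solution of the original problem is then the piece of
`t ↦ φ t (0, ξ)` around time `0` that stays in `U`: uniqueness for `b` identifies every solution in
`U` with such a piece (`IsSolution.eqOn_and_exitTime_le`), and no continuation argument is needed.

Since `a₁ > 0` on the hyperplane `x₁ = 0`, a trajectory can only cross it towards `x₁ > 0`
(`IsGlobalFlow.apply_zero_pos`). Therefore forward trajectories stay in the strip, so that
`T_max = ∞`, and by the group law no two points of the trajectories issued from the hyperplane
coincide (`IsGlobalFlow.eq_and_eq_of_eq`), which gives both disjointness and injectivity of `Φ`.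

The extension `b` is `C¹` only on `U`, but this suffices at points whose trajectory has stayed in
`U`. There the flow is strictly differentiable: the difference of two nearby trajectories is
compared, by Grönwall's inequality, with the solution of the equation linearised along one fixed
trajectory (`IsGlobalFlow.exists_linearization`). Strict differentiability on an open set implies
`C¹` (`contDiffOn_one_of_hasStrictFDerivAt`). The differential of `Φ` is injective, because
the backward flow reduces this to time `0`, where `a₁ ≠ 0` makes `a` transversal to the hyperplane
(`IsGlobalFlow.exists_hasStrictFDerivAt_injective`); with the inverse function theorem, `Φ` is a
diffeomorphism onto its image (`isC1DiffeoOn_of_injOn`).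

The value of `ℓ` comes from the bound `β / P * (exp (P * |t|) - 1)` on the displacement up to
time `t` (`IsGlobalFlow.neg_mem_strip`). If `a₁ ≥ α` everywhere, a point on the negative
side of the hyperplane, at distance less than both `L` and `α ℓ / 2`, reaches it in time less than
`ℓ`, while points on the positive side reach it backward in time
(`IsGlobalFlow.exists_eq_of_mem_strip`).
-/

/-! ### Global solutions of Lipschitz differential equations -/

namespace CharFlow

section GlobalExistence

variable {F : Type*} [NormedAddCommGroup F] [NormedSpace ℝ F]

open intervalIntegral in
/-- Integration from `0` gains a factor `1 / m` in the weighted norm with weight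
`exp (-m * |t|)`. -/
theorem norm_integral_le_exp_abs {f : ℝ → F} {c m : ℝ} (hm : 0 < m)
    (hf : ∀ s, ‖f s‖ ≤ c * Real.exp (m * |s|)) (t : ℝ) :
    ‖∫ s in (0 : ℝ)..t, f s‖ ≤ c / m * Real.exp (m * |t|) := by
  have hc : 0 ≤ c := by simpa using (norm_nonneg _).trans (hf 0)
  have key : ∀ (g : ℝ → F), (∀ s, ‖g s‖ ≤ c * Real.exp (m * |s|)) → ∀ t : ℝ, 0 ≤ t →
      ‖∫ s in (0 : ℝ)..t, g s‖ ≤ c / m * Real.exp (m * |t|) := by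
    intro g hg t ht
    have hd : ∀ s ∈ Set.uIcc 0 t,
        HasDerivAt (fun s => c / m * Real.exp (m * s)) (c * Real.exp (m * s)) s := by
      intro s _
      have h := (((hasDerivAt_id s).const_mul m).exp).const_mul (c / m)
      refine h.congr_deriv ?_
      simp only [id]
      field_simp
    have hi : IntervalIntegrable (fun s => c * Real.exp (m * s)) MeasureTheory.volume 0 t :=
      (by fun_prop : Continuous fun s => c * Real.exp (m * s)).intervalIntegrable _ _
    have h1 : ‖∫ s in (0 : ℝ)..t, g s‖ ≤ ∫ s in (0 : ℝ)..t, c * Real.exp (m * s) := by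
      refine norm_integral_le_of_norm_le ht (Filter.Eventually.of_forall fun s hs => ?_) hi
      simpa [abs_of_pos hs.1] using hg s
    rw [integral_eq_sub_of_hasDerivAt hd hi] at h1
    rw [abs_of_nonneg ht]
    have : 0 ≤ c / m * Real.exp (m * 0) := by positivity
    linarith
  rcases le_total 0 t with ht | ht
  · exact key f hf t ht
  · have h := key (fun s => f (-s)) (fun s => by simpa using hf (-s)) (-t) (by linarith)
    rw [integral_comp_neg, neg_zero, neg_neg, integral_symm, norm_neg, abs_neg] at h
    exact h

open BoundedContinuousFunction in
/-- A continuous time-dependent vector field which is Lipschitz in space, uniformly in time, and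
bounded at the origin has global solutions. A solution is found in the form
`t ↦ exp (m * |t|) • g t` with `g` bounded: in this weighted norm the Picard map is a contraction
of the whole space, for `m` larger than the Lipschitz constant. -/
theorem exists_global_solution [CompleteSpace F] {v : ℝ → F → F} {K : ℝ≥0} {C : ℝ}
    (hv : Continuous (Function.uncurry v)) (hK : ∀ t, LipschitzWith K (v t))
    (hC : ∀ t, ‖v t 0‖ ≤ C) (x₀ : F) :
    ∃ γ : ℝ → F, γ 0 = x₀ ∧ ∀ t, HasDerivAt γ (v t (γ t)) t := by
  set m : ℝ := K + 1 with hm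
  have hm0 : 0 < m := by positivity
  have hC0 : 0 ≤ C := (norm_nonneg _).trans (hC 0)
  -- the integrand and the two bounds it satisfies
  let I : (ℝ →ᵇ F) → ℝ → F := fun g s => v s (Real.exp (m * |s|) • g s)
  have hIc : ∀ g, Continuous (I g) := fun g =>
    hv.comp (continuous_id.prodMk (by have := g.continuous; fun_prop))
  have hIi : ∀ g a b, IntervalIntegrable (I g) MeasureTheory.volume a b :=
    fun g a b => (hIc g).intervalIntegrable a b
  have hIb : ∀ g s, ‖I g s‖ ≤ (C + K * ‖g‖) * Real.exp (m * |s|) := by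
    intro g s
    have h1 : 1 ≤ Real.exp (m * |s|) := Real.one_le_exp (by positivity)
    have h2 : ‖I g s - v s 0‖ ≤ K * (Real.exp (m * |s|) * ‖g‖) := by
      refine ((hK s).norm_sub_le _ _).trans ?_
      rw [sub_zero, norm_smul, Real.norm_of_nonneg (Real.exp_pos _).le]
      gcongr
      exact g.norm_coe_le_norm s
    have h3 : ‖I g s‖ ≤ ‖v s 0‖ + ‖I g s - v s 0‖ := norm_le_norm_add_norm_sub' _ _
    nlinarith [hC s]
  have hId : ∀ g h s, ‖I g s - I h s‖ ≤ (K * dist g h) * Real.exp (m * |s|) := by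
    intro g h s
    refine ((hK s).norm_sub_le _ _).trans ?_
    rw [← smul_sub, norm_smul, Real.norm_of_nonneg (Real.exp_pos _).le, mul_assoc,
      mul_comm (dist g h)]
    gcongr
    rw [← dist_eq_norm]
    exact g.dist_coe_le_dist s
  have hexp : ∀ t, Real.exp (-(m * |t|)) * Real.exp (m * |t|) = 1 := fun t => by
    rw [← Real.exp_add]; simp
  let T : (ℝ →ᵇ F) → (ℝ →ᵇ F) := fun g =>
    ofNormedAddCommGroup (fun t => Real.exp (-(m * |t|)) • (x₀ + ∫ s in (0 : ℝ)..t, I g s))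
      (by
        have := intervalIntegral.continuous_primitive (hIi g) 0
        fun_prop)
      (‖x₀‖ + (C + K * ‖g‖) / m) (by
        intro t
        rw [norm_smul, Real.norm_of_nonneg (Real.exp_pos _).le]
        have h1 : Real.exp (-(m * |t|)) ≤ 1 := Real.exp_le_one_iff.2 (by simp; positivity)
        calc Real.exp (-(m * |t|)) * ‖x₀ + ∫ s in (0 : ℝ)..t, I g s‖
            ≤ Real.exp (-(m * |t|)) * (‖x₀‖ + (C + K * ‖g‖) / m * Real.exp (m * |t|)) := by
              gcongr
              exact (norm_add_le _ _).trans
                (by gcongr; exact norm_integral_le_exp_abs hm0 (hIb g) t)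
          _ = Real.exp (-(m * |t|)) * ‖x₀‖ + (C + K * ‖g‖) / m *
                (Real.exp (-(m * |t|)) * Real.exp (m * |t|)) := by ring
          _ ≤ ‖x₀‖ + (C + K * ‖g‖) / m := by
              rw [hexp, mul_one]
              gcongr
              exact mul_le_of_le_one_left (norm_nonneg _) h1)
  have hT : ContractingWith (K / (K + 1)) T := by
    refine ⟨by rw [div_lt_one (by positivity)]; exact lt_add_one K, ?_⟩
    refine LipschitzWith.of_dist_le_mul fun g h => ?_
    refine (dist_le (by positivity)).2 fun t => ?_
    have e : T g t - T h t =
        Real.exp (-(m * |t|)) • ∫ s in (0 : ℝ)..t, (I g s - I h s) := by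
      rw [intervalIntegral.integral_sub (hIi g 0 t) (hIi h 0 t)]
      simp only [T, coe_ofNormedAddCommGroup, ← smul_sub]
      congr 1
      abel
    rw [dist_eq_norm, e, norm_smul, Real.norm_of_nonneg (Real.exp_pos _).le]
    calc Real.exp (-(m * |t|)) * ‖∫ s in (0 : ℝ)..t, (I g s - I h s)‖
        ≤ Real.exp (-(m * |t|)) * (K * dist g h / m * Real.exp (m * |t|)) := by
          gcongr
          exact norm_integral_le_exp_abs hm0 (hId g h) t
      _ = K * dist g h / m * (Real.exp (-(m * |t|)) * Real.exp (m * |t|)) := by ring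
      _ = ((K / (K + 1) : ℝ≥0) : ℝ) * dist g h := by
          rw [hexp, hm]; push_cast; ring
  let g := hT.fixedPoint T
  have hg : ∀ t, Real.exp (m * |t|) • g t = x₀ + ∫ s in (0 : ℝ)..t, I g s := by
    intro t
    have h : T g = g := hT.fixedPoint_isFixedPt
    conv_lhs => rw [← h]
    simp only [T, coe_ofNormedAddCommGroup]
    rw [smul_smul, mul_comm, hexp, one_smul]
  refine ⟨fun t => Real.exp (m * |t|) • g t, by simpa using hg 0, fun t => ?_⟩
  have h := ((intervalIntegral.integral_hasDerivAt_right (hIi g 0 t)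
    ((hIc g).stronglyMeasurableAtFilter _ _) (hIc g).continuousAt).const_add x₀)
  exact h.congr_of_eventuallyEq (Filter.Eventually.of_forall hg)

/-- Grönwall's inequality on both sides of the initial time `0`. -/
theorem norm_le_gronwallBound_abs {f f' : ℝ → F} {K ε s : ℝ}
    (hf : ∀ r ∈ Set.uIcc 0 s, HasDerivAt f (f' r) r)
    (bound : ∀ r ∈ Set.uIcc 0 s, ‖f' r‖ ≤ K * ‖f r‖ + ε) :
    ‖f s‖ ≤ gronwallBound ‖f 0‖ K ε |s| := by
  rcases le_total 0 s with hs | hs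
  · rw [Set.uIcc_of_le hs] at hf bound
    have h := norm_le_gronwallBound_of_norm_deriv_right_le (f := f) (f' := f') (δ := ‖f 0‖)
      (fun r hr => (hf r hr).continuousAt.continuousWithinAt)
      (fun r hr => (hf r (Set.Ico_subset_Icc_self hr)).hasDerivWithinAt) le_rfl
      (fun r hr => bound r (Set.Ico_subset_Icc_self hr)) s ⟨hs, le_rfl⟩
    rw [abs_of_nonneg hs]
    simpa using h
  · rw [Set.uIcc_of_ge hs] at hf bound
    have hm : ∀ r ∈ Set.Icc 0 (-s), -r ∈ Set.Icc s 0 :=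
      fun r hr => ⟨by linarith [hr.2], by linarith [hr.1]⟩
    have hd : ∀ r ∈ Set.Icc 0 (-s), HasDerivAt (fun r => f (-r)) (-f' (-r)) r := by
      intro r hr
      simpa [Function.comp_def] using (hf (-r) (hm r hr)).scomp r (hasDerivAt_neg r)
    have h := norm_le_gronwallBound_of_norm_deriv_right_le (f := fun r => f (-r))
      (f' := fun r => -f' (-r)) (δ := ‖f 0‖)
      (fun r hr => (hd r hr).continuousAt.continuousWithinAt)
      (fun r hr => (hd r (Set.Ico_subset_Icc_self hr)).hasDerivWithinAt) (by simp)
      (fun r hr => by simpa using bound (-r) (hm r (Set.Ico_subset_Icc_self hr)))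
      (-s) ⟨by linarith, le_rfl⟩
    rw [abs_of_nonpos hs]
    simpa using h

/-- `φ` is the global flow of the vector field `b`: the curve `t ↦ φ t x` solves `x' = b x` for all
times and starts at `x`. -/
structure IsGlobalFlow (b : F → F) (φ : ℝ → F → F) : Prop where
  zero : ∀ x, φ 0 x = x
  hasDerivAt : ∀ t x, HasDerivAt (fun t => φ t x) (b (φ t x)) t

theorem exists_isGlobalFlow [CompleteSpace F] {b : F → F} {K : ℝ≥0} (hb : LipschitzWith K b) :
    ∃ φ : ℝ → F → F, IsGlobalFlow b φ := by
  have h := fun x₀ => exists_global_solution (v := fun _ => b)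
    (by exact hb.continuous.comp continuous_snd) (fun _ => hb) (fun _ => le_rfl) x₀
  choose γ h0 h1 using h
  exact ⟨fun t x => γ x t, h0, fun t x => h1 x t⟩

namespace IsGlobalFlow

variable {b : F → F} {K : ℝ≥0} {φ : ℝ → F → F}

theorem add (hφ : IsGlobalFlow b φ) (hb : LipschitzWith K b) (s t : ℝ) (x : F) :
    φ s (φ t x) = φ (s + t) x := by
  have h := ODE_solution_unique_univ (v := fun _ => b) (s := fun _ => Set.univ) (K := K)
    (f := fun s => φ s (φ t x)) (g := fun s => φ (s + t) x) (t₀ := 0)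
    (fun _ => hb.lipschitzOnWith) (fun s => ⟨hφ.hasDerivAt s _, trivial⟩)
    (fun s => ⟨(hφ.hasDerivAt (s + t) x).comp_add_const s t, trivial⟩) (by simp [hφ.zero])
  exact congrFun h s

theorem neg_cancel (hφ : IsGlobalFlow b φ) (hb : LipschitzWith K b) (t : ℝ) (x : F) :
    φ (-t) (φ t x) = x := by
  rw [hφ.add hb, neg_add_cancel, hφ.zero]

theorem norm_flow_sub_le (hφ : IsGlobalFlow b φ) (hb : LipschitzWith K b) (t : ℝ) (x y : F) :
    ‖φ t x - φ t y‖ ≤ ‖x - y‖ * Real.exp (K * |t|) := by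
  have h := norm_le_gronwallBound_abs (f := fun t => φ t x - φ t y)
    (f' := fun t => b (φ t x) - b (φ t y)) (K := K) (ε := 0) (s := t)
    (fun r _ => (hφ.hasDerivAt r x).sub (hφ.hasDerivAt r y))
    (fun r _ => by simpa using hb.norm_sub_le _ _)
  simpa [gronwallBound_ε0, hφ.zero] using h

theorem continuous_left (hφ : IsGlobalFlow b φ) (x : F) : Continuous fun t => φ t x :=
  continuous_iff_continuousAt.2 fun t => (hφ.hasDerivAt t x).continuousAt

theorem continuous (hφ : IsGlobalFlow b φ) (hb : LipschitzWith K b) :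
    Continuous (Function.uncurry φ) := by
  refine continuous_iff_continuousAt.2 fun ⟨t₀, x₀⟩ => ?_
  rw [ContinuousAt, tendsto_iff_norm_sub_tendsto_zero]
  have h : Filter.Tendsto (fun p : ℝ × F => ‖p.2 - x₀‖ * Real.exp (K * |p.1|) +
      ‖φ p.1 x₀ - φ t₀ x₀‖) (nhds (t₀, x₀)) (nhds 0) := by
    have hc : Continuous fun p : ℝ × F => ‖p.2 - x₀‖ * Real.exp (K * |p.1|) +
        ‖φ p.1 x₀ - φ t₀ x₀‖ := by
      have h1 : Continuous fun p : ℝ × F => φ p.1 x₀ := (hφ.continuous_left x₀).comp continuous_fst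
      have h2 : Continuous fun p : ℝ × F => ‖p.2 - x₀‖ * Real.exp (K * |p.1|) := by fun_prop
      exact h2.add (h1.sub continuous_const).norm
    simpa using hc.tendsto (t₀, x₀)
  refine squeeze_zero (fun _ => norm_nonneg _) (fun p => ?_) h
  refine (norm_sub_le_norm_sub_add_norm_sub _ (φ p.1 x₀) _).trans ?_
  exact add_le_add_left (hφ.norm_flow_sub_le hb _ _ _) _

/-- Uniqueness on an open interval of times around `0`. -/
theorem eqOn (hφ : IsGlobalFlow b φ) (hb : LipschitzWith K b) {x₀ : F} {y : ℝ → F} (h0 : y 0 = x₀)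
    {c d : ℝ} (hc : c < 0) (hd : 0 < d) (hy : ∀ t ∈ Set.Ioo c d, HasDerivAt y (b (y t)) t) :
    Set.EqOn y (fun t => φ t x₀) (Set.Ioo c d) :=
  ODE_solution_unique_of_mem_Ioo (v := fun _ => b) (s := fun _ => Set.univ) (K := K) (t₀ := 0)
    (fun _ _ => hb.lipschitzOnWith) ⟨hc, hd⟩ (fun t ht => ⟨hy t ht, trivial⟩)
    (fun t _ => ⟨hφ.hasDerivAt t _, trivial⟩) (by simp [h0, hφ.zero])

end IsGlobalFlow

end GlobalExistence

end CharFlow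

/-! ### Differentiability of the flow -/

namespace CharFlow

section Differentiability

open Filter Topology

variable {F G : Type*} [NormedAddCommGroup F] [NormedSpace ℝ F]
  [NormedAddCommGroup G] [NormedSpace ℝ G]

/-- The differential of the flow in the initial condition is the solution `M` of the linearised
equation `M' = Db(φ t x₀) ∘ M`, `M 0 = id`. For two initial conditions `y`, `z` the remainder
`φ t y - φ t z - M t (y - z)` solves the same linear equation up to a source term `o(y - z)`, so
it is `o(y - z)` by Grönwall's inequality, uniformly in time. -/
theorem IsGlobalFlow.exists_linearization [CompleteSpace F] {b : F → F} {K : ℝ≥0} {φ : ℝ → F → F}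
    (hφ : IsGlobalFlow b φ) (hb : LipschitzWith K b) {x₀ : F} {c d : ℝ} (hc : c < 0) (hd : 0 < d)
    (hx : ∀ r ∈ Set.Icc c d, ContDiffAt ℝ 1 b (φ r x₀)) :
    ∃ M : ℝ → F →L[ℝ] F, Continuous M ∧ ∀ ε > 0, ∀ᶠ q : F × F in 𝓝 (x₀, x₀),
      ∀ r ∈ Set.Icc c d, ‖φ r q.1 - φ r q.2 - M r (q.1 - q.2)‖ ≤ ε * ‖q.1 - q.2‖ := by
  have hcd : c ≤ d := (hc.trans hd).le
  -- the coefficient of the linearised equation, frozen outside `[c, d]`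
  let A : ℝ → F →L[ℝ] F := fun r => fderiv ℝ b (φ (Set.projIcc c d hcd r) x₀)
  have hAc : Continuous A := by
    refine continuous_iff_continuousAt.2 fun r => ?_
    have h1 : ContinuousAt (fderiv ℝ b) (φ (Set.projIcc c d hcd r) x₀) :=
      ((hx _ (Set.projIcc c d hcd r).2).fderiv_right (m := 0) (by norm_num)).continuousAt
    have h2 : Continuous fun r => φ (Set.projIcc c d hcd r) x₀ :=
      (hφ.continuous_left x₀).comp (continuous_subtype_val.comp continuous_projIcc)
    exact ContinuousAt.comp (f := fun r => φ (Set.projIcc c d hcd r) x₀) h1 h2.continuousAt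
  have hAK : ∀ r, ‖A r‖ ≤ K := fun r => norm_fderiv_le_of_lipschitz ℝ hb
  have hAeq : ∀ r ∈ Set.Icc c d, A r = fderiv ℝ b (φ r x₀) := fun r hr => by
    simp only [A, Set.projIcc_of_mem hcd hr]
  obtain ⟨M, hM0, hM⟩ := exists_global_solution (F := F →L[ℝ] F) (K := K) (C := 0)
    (v := fun r N => (A r).comp N) (by exact (hAc.comp continuous_fst).clm_comp continuous_snd)
    (fun r => LipschitzWith.of_dist_le_mul fun N N' => by
      rw [dist_eq_norm, dist_eq_norm, ← ContinuousLinearMap.comp_sub]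
      exact (ContinuousLinearMap.opNorm_comp_le _ _).trans (by gcongr; exact hAK r))
    (fun r => by simp) (ContinuousLinearMap.id ℝ F)
  refine ⟨M, continuous_iff_continuousAt.2 fun r => (hM r).continuousAt, fun ε hε => ?_⟩
  set R : ℝ := max |c| |d|
  set C : ℝ := Real.exp (K * R) * Real.exp ((K + 1) * R) with hC
  have hR : ∀ r ∈ Set.Icc c d, |r| ≤ R := fun r hr => abs_le_max_abs_abs hr.1 hr.2
  have key : ∀ᶠ q : F × F in 𝓝 (x₀, x₀), ∀ r ∈ Set.Icc c d,
      ‖b (φ r q.1) - b (φ r q.2) - A r (φ r q.1 - φ r q.2)‖ ≤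
        ε / C * ‖φ r q.1 - φ r q.2‖ := by
    refine isCompact_Icc.eventually_forall_of_forall_eventually
      (P := fun (q : F × F) r => ‖b (φ r q.1) - b (φ r q.2) - A r (φ r q.1 - φ r q.2)‖ ≤
        ε / C * ‖φ r q.1 - φ r q.2‖) fun r₀ hr₀ => ?_
    have h1 : ∀ᶠ z : F × F in 𝓝 (φ r₀ x₀, φ r₀ x₀),
        ‖b z.1 - b z.2 - A r₀ (z.1 - z.2)‖ ≤ ε / C / 2 * ‖z.1 - z.2‖ := by
      rw [hAeq r₀ hr₀]
      exact (hasStrictFDerivAt_iff_isLittleO.1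
        ((hx r₀ hr₀).hasStrictFDerivAt one_ne_zero)).def (by positivity)
    have h2 : Tendsto (fun w : (F × F) × ℝ => (φ w.2 w.1.1, φ w.2 w.1.2)) (𝓝 ((x₀, x₀), r₀))
        (𝓝 (φ r₀ x₀, φ r₀ x₀)) := by
      have h := hφ.continuous hb
      have : Continuous fun w : (F × F) × ℝ => (φ w.2 w.1.1, φ w.2 w.1.2) :=
        (h.comp (continuous_snd.prodMk (continuous_fst.comp continuous_fst))).prodMk
          (h.comp (continuous_snd.prodMk (continuous_snd.comp continuous_fst)))
      exact this.tendsto _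
    have h3 : ∀ᶠ w : (F × F) × ℝ in 𝓝 ((x₀, x₀), r₀), ‖A w.2 - A r₀‖ < ε / C / 2 := by
      have : Continuous fun w : (F × F) × ℝ => ‖A w.2 - A r₀‖ := by fun_prop
      exact this.continuousAt.eventually_lt continuousAt_const (by simpa using by positivity)
    filter_upwards [h2.eventually h1, h3] with w hw1 hw3
    set Δ := φ w.2 w.1.1 - φ w.2 w.1.2
    calc ‖b (φ w.2 w.1.1) - b (φ w.2 w.1.2) - A w.2 Δ‖
        = ‖(b (φ w.2 w.1.1) - b (φ w.2 w.1.2) - A r₀ Δ) - (A w.2 - A r₀) Δ‖ := by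
          congr 1; simp
      _ ≤ ε / C / 2 * ‖Δ‖ + ε / C / 2 * ‖Δ‖ :=
          (norm_sub_le _ _).trans (add_le_add hw1
            ((ContinuousLinearMap.le_opNorm _ _).trans (by gcongr)))
      _ = ε / C * ‖Δ‖ := by ring
  filter_upwards [key] with q hq r hr
  have hsub : Set.uIcc 0 r ⊆ Set.Icc c d :=
    Set.uIcc_subset_Icc ⟨hc.le, hd.le⟩ hr
  set e : ℝ := ε / C * (‖q.1 - q.2‖ * Real.exp (K * R))
  have hg := norm_le_gronwallBound_abs
    (f := fun r => φ r q.1 - φ r q.2 - M r (q.1 - q.2))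
    (f' := fun r => b (φ r q.1) - b (φ r q.2) - A r (M r (q.1 - q.2))) (K := K + 1) (ε := e)
    (s := r)
    (fun r _ => ((hφ.hasDerivAt r _).sub (hφ.hasDerivAt r _)).sub
      (by simpa using (hM r).clm_apply (hasDerivAt_const r (q.1 - q.2))))
    (fun r hr => by
      have h1 := hq r (hsub hr)
      have h2 : ‖φ r q.1 - φ r q.2‖ ≤ ‖q.1 - q.2‖ * Real.exp (K * R) :=
        (hφ.norm_flow_sub_le hb _ _ _).trans (by gcongr; exact hR r (hsub hr))
      calc ‖b (φ r q.1) - b (φ r q.2) - A r (M r (q.1 - q.2))‖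
          = ‖A r (φ r q.1 - φ r q.2 - M r (q.1 - q.2)) +
              (b (φ r q.1) - b (φ r q.2) - A r (φ r q.1 - φ r q.2))‖ := by
            congr 1; simp only [map_sub]; abel
        _ ≤ K * ‖φ r q.1 - φ r q.2 - M r (q.1 - q.2)‖ + e :=
            (norm_add_le _ _).trans (add_le_add
              ((ContinuousLinearMap.le_opNorm _ _).trans (by gcongr; exact hAK r))
              (h1.trans (mul_le_mul_of_nonneg_left h2 (by positivity))))
        _ ≤ _ := by
            gcongr
            simp)
  have hK : (K : ℝ) + 1 ≠ 0 := by positivity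
  have he : 0 ≤ e := by positivity
  rw [gronwallBound_of_K_ne_0 hK] at hg
  simp only [hφ.zero, hM0, ContinuousLinearMap.id_apply, sub_self, norm_zero, zero_mul,
    zero_add] at hg
  calc ‖φ r q.1 - φ r q.2 - M r (q.1 - q.2)‖
      ≤ e / (K + 1) * (Real.exp ((K + 1) * |r|) - 1) := hg
    _ ≤ e * Real.exp ((K + 1) * R) := by
        have h1 : e / (K + 1) ≤ e := div_le_self he (by simp)
        have h2 : Real.exp ((K + 1) * |r|) - 1 ≤ Real.exp ((K + 1) * R) := by
          have : Real.exp ((K + 1) * |r|) ≤ Real.exp ((K + 1) * R) := by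
            gcongr
            exact hR r hr
          linarith
        have h3 : 0 ≤ Real.exp ((K + 1) * |r|) - 1 := by
          have := Real.one_le_exp (x := (K + 1) * |r|) (by positivity)
          linarith
        gcongr
    _ = ε * ‖q.1 - q.2‖ * (Real.exp (K * R) * Real.exp ((K + 1) * R) / C) := by
        simp only [e]; ring
    _ = ε * ‖q.1 - q.2‖ := by rw [hC, div_self (by positivity), mul_one]

/-- The flow is strictly differentiable, jointly in time and initial condition, at any point whose
trajectory up to that time stays where the vector field is `C¹`. -/
theorem IsGlobalFlow.exists_hasStrictFDerivAt [CompleteSpace F] {b : F → F} {K : ℝ≥0}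
    {φ : ℝ → F → F} (hφ : IsGlobalFlow b φ) (hb : LipschitzWith K b) {x₀ : F} {c d t₀ : ℝ}
    (hc : c < 0) (hd : 0 < d) (ht₀ : t₀ ∈ Set.Ioo c d)
    (hx : ∀ r ∈ Set.Icc c d, ContDiffAt ℝ 1 b (φ r x₀)) :
    ∃ D : ℝ × F →L[ℝ] F, HasStrictFDerivAt (Function.uncurry φ) D (t₀, x₀) := by
  obtain ⟨M, hMc, hM⟩ := hφ.exists_linearization hb hc hd hx
  set w := b (φ t₀ x₀) with hw
  refine ⟨(ContinuousLinearMap.toSpanSingleton ℝ w).coprod (M t₀), ?_⟩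
  rw [hasStrictFDerivAt_iff_isLittleO, Asymptotics.isLittleO_iff]
  intro ε hε
  have h1 : ∀ᶠ p : (ℝ × F) × (ℝ × F) in 𝓝 ((t₀, x₀), (t₀, x₀)),
      ∀ r ∈ Set.Icc c d, ‖φ r p.1.2 - φ r p.2.2 - M r (p.1.2 - p.2.2)‖ ≤
        ε / 3 * ‖p.1.2 - p.2.2‖ := by
    have : Continuous fun p : (ℝ × F) × (ℝ × F) => (p.1.2, p.2.2) := by fun_prop
    exact (this.tendsto ((t₀, x₀), (t₀, x₀))).eventually (hM (ε / 3) (by positivity))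
  have h2 : ∀ᶠ p : (ℝ × F) × (ℝ × F) in 𝓝 ((t₀, x₀), (t₀, x₀)), p.1.1 ∈ Set.Icc c d := by
    have : Continuous fun p : (ℝ × F) × (ℝ × F) => p.1.1 := by fun_prop
    exact (this.tendsto ((t₀, x₀), (t₀, x₀))).eventually (Icc_mem_nhds ht₀.1 ht₀.2)
  have h3 : ∀ᶠ p : (ℝ × F) × (ℝ × F) in 𝓝 ((t₀, x₀), (t₀, x₀)),
      ‖M p.1.1 - M t₀‖ < ε / 3 := by
    have : Continuous fun p : (ℝ × F) × (ℝ × F) => ‖M p.1.1 - M t₀‖ := by fun_prop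
    exact this.continuousAt.eventually_lt continuousAt_const (by simpa using by positivity)
  -- on a small ball the velocity is almost constant, which controls the time increments
  obtain ⟨ρ, hρ, hball⟩ : ∃ ρ > 0, ∀ p ∈ Metric.ball (t₀, x₀) ρ, ‖b (φ p.1 p.2) - w‖ ≤ ε / 3 := by
    have : Continuous fun p : ℝ × F => ‖b (φ p.1 p.2) - w‖ :=
      ((hb.continuous.comp (hφ.continuous hb)).sub continuous_const).norm
    have h := this.continuousAt.eventually_lt (x₀ := (t₀, x₀)) (g := fun _ => ε / 3)
      continuousAt_const (by simpa [hw] using by positivity)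
    obtain ⟨ρ, hρ, h⟩ := Metric.eventually_nhds_iff_ball.1 h
    exact ⟨ρ, hρ, fun p hp => (h p hp).le⟩
  have h4 : ∀ᶠ p : (ℝ × F) × (ℝ × F) in 𝓝 ((t₀, x₀), (t₀, x₀)),
      ‖φ p.1.1 p.2.2 - φ p.2.1 p.2.2 - (p.1.1 - p.2.1) • w‖ ≤ ε / 3 * ‖p.1.1 - p.2.1‖ := by
    have hn : Metric.ball (t₀, x₀) ρ ×ˢ Metric.ball (t₀, x₀) ρ ∈ 𝓝 ((t₀, x₀), (t₀, x₀)) :=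
      prod_mem_nhds (Metric.ball_mem_nhds _ hρ) (Metric.ball_mem_nhds _ hρ)
    filter_upwards [hn] with p hp
    rw [← ball_prod_same] at hp
    obtain ⟨⟨hp1, -⟩, ⟨hp2, hp3⟩⟩ := hp
    have h := (convex_ball t₀ ρ).norm_image_sub_le_of_norm_hasDerivWithin_le (C := ε / 3)
      (f := fun r => φ r p.2.2 - r • w) (f' := fun r => b (φ r p.2.2) - w)
      (fun r _ => (((hφ.hasDerivAt r _).sub
        (by simpa using (hasDerivAt_id r).smul_const w))).hasDerivWithinAt)
      (fun r hr => hball (r, p.2.2) (by rw [← ball_prod_same]; exact ⟨hr, hp3⟩)) hp2 hp1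
    convert h using 2
    rw [sub_smul]
    abel
  filter_upwards [h1, h2, h3, h4] with p hp1 hp2 hp3 hp4
  have hn1 : ‖p.1.1 - p.2.1‖ ≤ ‖p.1 - p.2‖ := norm_fst_le (p.1 - p.2)
  have hn2 : ‖p.1.2 - p.2.2‖ ≤ ‖p.1 - p.2‖ := norm_snd_le (p.1 - p.2)
  have e : Function.uncurry φ p.1 - Function.uncurry φ p.2 -
      ((ContinuousLinearMap.toSpanSingleton ℝ w).coprod (M t₀)) (p.1 - p.2) =
      (φ p.1.1 p.1.2 - φ p.1.1 p.2.2 - M p.1.1 (p.1.2 - p.2.2)) +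
      (M p.1.1 - M t₀) (p.1.2 - p.2.2) +
      (φ p.1.1 p.2.2 - φ p.2.1 p.2.2 - (p.1.1 - p.2.1) • w) := by
    simp only [Function.uncurry, ContinuousLinearMap.coprod_apply, Prod.fst_sub, Prod.snd_sub,
      ContinuousLinearMap.toSpanSingleton_apply, sub_apply]
    abel
  rw [e]
  calc _ ≤ ε / 3 * ‖p.1.2 - p.2.2‖ + ε / 3 * ‖p.1.2 - p.2.2‖ + ε / 3 * ‖p.1.1 - p.2.1‖ :=
        norm_add₃_le.trans (add_le_add (add_le_add (hp1 _ hp2)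
          ((ContinuousLinearMap.le_opNorm _ _).trans (by gcongr))) hp4)
    _ ≤ ε / 3 * ‖p.1 - p.2‖ + ε / 3 * ‖p.1 - p.2‖ + ε / 3 * ‖p.1 - p.2‖ := by gcongr
    _ = ε * ‖p.1 - p.2‖ := by ring

/-- Strict differentiability at every point of an open set forces the derivative to be
continuous. -/
theorem contDiffOn_one_of_hasStrictFDerivAt {f : F → G} {s : Set F} (hs : IsOpen s)
    (h : ∀ x ∈ s, ∃ D : F →L[ℝ] G, HasStrictFDerivAt f D x) : ContDiffOn ℝ 1 f s := by
  have hd : ∀ x ∈ s, HasStrictFDerivAt f (fderiv ℝ f x) x := fun x hx => by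
    obtain ⟨D, hD⟩ := h x hx
    rwa [hD.hasFDerivAt.fderiv]
  intro x hx
  refine (contDiffAt_one_iff.2 ⟨fderiv ℝ f, s, hs.mem_nhds hx, fun x hx => ?_,
    fun x hx => (hd x hx).hasFDerivAt⟩).contDiffWithinAt
  refine ContinuousAt.continuousWithinAt (Metric.continuousAt_iff'.2 fun ε hε => ?_)
  have h1 := (hasStrictFDerivAt_iff_isLittleO.1 (hd x hx)).def (half_pos hε)
  obtain ⟨δ, hδ, hball⟩ := Metric.eventually_nhds_iff_ball.1 h1
  filter_upwards [hs.mem_nhds hx, Metric.ball_mem_nhds x hδ] with y hy hyδ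
  rw [dist_eq_norm]
  refine lt_of_le_of_lt ?_ (half_lt_self hε)
  refine ((hd y hy).hasFDerivAt.sub (fderiv ℝ f x).hasFDerivAt).le_of_lip' (half_pos hε).le ?_
  filter_upwards [Metric.isOpen_ball.mem_nhds hyδ] with z hz
  have h2 := hball (z, y) (by rw [← ball_prod_same]; exact ⟨hz, hyδ⟩)
  refine le_of_eq_of_le ?_ h2
  simp only [Pi.sub_apply, map_sub]
  congr 1
  abel

/-- An injective `C¹` map on an open set whose differential is injective, between spaces of the
same finite dimension, is a `C¹`-diffeomorphism onto its open image. -/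
theorem isC1DiffeoOn_of_injOn [FiniteDimensional ℝ F] [FiniteDimensional ℝ G] {f : F → G}
    {s : Set F} (hdim : Module.finrank ℝ F = Module.finrank ℝ G) (hs : IsOpen s)
    (hf : ContDiffOn ℝ 1 f s) (hinj : Set.InjOn f s)
    (hD : ∀ x ∈ s, Function.Injective (fderiv ℝ f x)) : IsC1DiffeoOn f s := by
  have : CompleteSpace F := FiniteDimensional.complete ℝ F
  have hequiv : ∀ x ∈ s, ∃ L : F ≃L[ℝ] G, HasStrictFDerivAt f (L : F →L[ℝ] G) x := by
    intro x hx
    let L := (LinearEquiv.ofInjectiveOfFinrankEq (fderiv ℝ f x : F →ₗ[ℝ] G) (hD x hx)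
      hdim).toContinuousLinearEquiv
    refine ⟨L, ?_⟩
    have hL : (L : F →L[ℝ] G) = fderiv ℝ f x := by ext v; rfl
    rw [hL]
    exact (hf.contDiffAt (hs.mem_nhds hx)).hasStrictFDerivAt one_ne_zero
  have hopen : ∀ t ⊆ s, IsOpen t → IsOpen (f '' t) := by
    intro t hts ht
    rw [isOpen_iff_mem_nhds]
    rintro _ ⟨x, hx, rfl⟩
    obtain ⟨L, hL⟩ := hequiv x (hts hx)
    rw [← hL.map_nhds_eq_of_equiv]
    exact Filter.image_mem_map (ht.mem_nhds hx)
  have hmap : IsOpenMap (s.domRestrict f) := by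
    intro t ht
    have h := hopen _ (Subtype.coe_image_subset s t) (hs.isOpenMap_subtype_val t ht)
    rwa [Set.image_image] at h
  let e : OpenPartialHomeomorph F G :=
    OpenPartialHomeomorph.ofContinuousOpenRestrict (hinj.toPartialEquiv f s) hf.continuousOn hmap hs
  refine ⟨hs, hopen s subset_rfl hs, hf, e.symm, fun y hy => ?_, fun x hx => e.left_inv hx⟩
  have hy' : e.symm y ∈ s := e.map_target hy
  obtain ⟨L, hL⟩ := hequiv _ hy'
  exact (e.contDiffAt_symm hy hL.hasFDerivAt
    (hf.contDiffAt (hs.mem_nhds hy'))).contDiffWithinAt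

end Differentiability

end CharFlow

/-! ### The hyperplane `x₁ = 0` -/

namespace CharFlow

open Filter Topology

section Hyperplane

variable {n : ℕ}

theorem point_apply_zero (x₁ : ℝ) (ξ : E n) : point x₁ ξ 0 = x₁ := rfl

/-- The linear embedding `ξ ↦ (0, ξ)` of the hyperplane `x₁ = 0`. -/
noncomputable def pointCLM (n : ℕ) : E n →L[ℝ] E (n + 1) :=
  LinearMap.toContinuousLinearMap
    { toFun := point 0
      map_add' := fun ξ η => by
        ext i
        refine Fin.cases ?_ (fun j => ?_) i
        · exact (add_zero (0 : ℝ)).symm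
        · rfl
      map_smul' := fun c ξ => by
        ext i
        refine Fin.cases ?_ (fun j => ?_) i
        · exact (mul_zero c).symm
        · rfl }

theorem point_injective : Function.Injective (point (n := n) 0) := by
  intro ξ η h
  ext i
  exact congrArg (fun x : E (n + 1) => x i.succ) h

theorem exists_eq_point {x : E (n + 1)} (hx : x 0 = 0) : ∃ ξ : E n, x = point 0 ξ := by
  refine ⟨WithLp.toLp 2 fun i => x i.succ, ?_⟩
  ext i
  exact Fin.cases hx (fun _ => rfl) i

theorem point_mem_strip {L : ℝ} (hL : 0 < L) (ξ : E n) : point 0 ξ ∈ strip n L := by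
  simpa [strip, point_apply_zero] using hL

variable {b : E (n + 1) → E (n + 1)} {K : ℝ≥0} {φ : ℝ → E (n + 1) → E (n + 1)}

theorem IsGlobalFlow.hasDerivAt_apply (hφ : IsGlobalFlow b φ) (t : ℝ) (x : E (n + 1))
    (i : Fin (n + 1)) : HasDerivAt (fun t => φ t x i) (b (φ t x) i) t :=
  (EuclideanSpace.proj (𝕜 := ℝ) i).hasFDerivAt.comp_hasDerivAt t (hφ.hasDerivAt t x)

/-- All trajectories cross the hyperplane `x₁ = 0` towards increasing `x₁`, so they stay on the
positive side afterwards. -/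
theorem IsGlobalFlow.apply_zero_pos (hφ : IsGlobalFlow b φ)
    (hin : ∀ ξ : E n, 0 < b (point 0 ξ) 0) (ξ : E n) {s : ℝ} (hs : 0 < s) :
    0 < φ s (point 0 ξ) 0 := by
  have hz : ∀ s, φ s (point 0 ξ) 0 = 0 → 0 < b (φ s (point 0 ξ)) 0 := fun s h => by
    obtain ⟨η, hη⟩ := exists_eq_point h
    rw [hη]
    exact hin η
  have hnn : ∀ r, 0 ≤ r → 0 ≤ φ r (point 0 ξ) 0 := by
    intro r hr
    have h := image_le_of_deriv_right_lt_deriv_boundary (f := fun t => -φ t (point 0 ξ) 0)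
      (f' := fun t => -b (φ t (point 0 ξ)) 0) (a := 0) (b := r) (B := fun _ => 0)
      (B' := fun _ => 0)
      (fun t _ => (hφ.hasDerivAt_apply t _ 0).neg.continuousAt.continuousWithinAt)
      (fun t _ => (hφ.hasDerivAt_apply t _ 0).neg.hasDerivWithinAt)
      (by simp [hφ.zero, point_apply_zero]) (fun t => hasDerivAt_const t 0)
      (fun t _ ht => by simpa using hz t (by simpa using ht)) ⟨hr, le_rfl⟩
    simpa using h
  refine (hnn s hs.le).lt_of_ne fun h0 => ?_
  -- a zero at a positive time would be a local minimum, with vanishing derivative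
  have hmin : IsLocalMin (fun t => φ t (point 0 ξ) 0) s := by
    filter_upwards [lt_mem_nhds hs] with r hr
    rw [← h0]
    exact hnn r hr.le
  exact (hz s h0.symm).ne' (hmin.hasDerivAt_eq_zero (hφ.hasDerivAt_apply s _ 0))

theorem IsGlobalFlow.eq_zero_of_apply_zero (hφ : IsGlobalFlow b φ) (hb : LipschitzWith K b)
    (hin : ∀ ξ : E n, 0 < b (point 0 ξ) 0) {ξ : E n} {s : ℝ} (h : φ s (point 0 ξ) 0 = 0) :
    s = 0 := by
  rcases lt_trichotomy s 0 with hs | hs | hs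
  · obtain ⟨η, hη⟩ := exists_eq_point h
    have h1 := hφ.apply_zero_pos hin η (neg_pos.2 hs)
    rw [← hη, hφ.neg_cancel hb, point_apply_zero] at h1
    exact absurd h1 (lt_irrefl 0)
  · exact hs
  · exact absurd h (hφ.apply_zero_pos hin ξ hs).ne'

/-- Trajectories issued from the hyperplane are injective and pairwise disjoint: two coinciding
points produce, by the group law, a trajectory that returns to the hyperplane. -/
theorem IsGlobalFlow.eq_and_eq_of_eq (hφ : IsGlobalFlow b φ) (hb : LipschitzWith K b)
    (hin : ∀ ξ : E n, 0 < b (point 0 ξ) 0) {ξ η : E n} {s t : ℝ}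
    (h : φ s (point 0 ξ) = φ t (point 0 η)) : s = t ∧ ξ = η := by
  have h1 : φ (-t + s) (point 0 ξ) = point 0 η := by
    rw [← hφ.add hb, h, hφ.neg_cancel hb]
  have h2 : -t + s = 0 := hφ.eq_zero_of_apply_zero hb hin (by rw [h1, point_apply_zero])
  refine ⟨by linarith, ?_⟩
  rw [h2, hφ.zero] at h1
  exact point_injective h1

/-- The differential of `(s, ξ) ↦ φ s (0, ξ)` exists and is injective: composed with the
differential of `φ (-t₀)` it becomes the differential at time `0`, which sends `(σ, η)` to
`σ • b (0, ξ₀) + (0, η)`, and `b (0, ξ₀)` is transversal to the hyperplane. -/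
theorem IsGlobalFlow.exists_hasStrictFDerivAt_injective (hφ : IsGlobalFlow b φ)
    (hb : LipschitzWith K b) (hin : ∀ ξ : E n, 0 < b (point 0 ξ) 0) {ξ₀ : E n} {c d t₀ : ℝ}
    (hc : c < 0) (hd : 0 < d) (ht₀ : t₀ ∈ Set.Ioo c d)
    (hx : ∀ r ∈ Set.Icc c d, ContDiffAt ℝ 1 b (φ r (point 0 ξ₀))) :
    ∃ D : ℝ × E n →L[ℝ] E (n + 1),
      HasStrictFDerivAt (fun p : ℝ × E n => φ p.1 (point 0 p.2)) D (t₀, ξ₀) ∧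
        Function.Injective D := by
  have key : ∀ t ∈ Set.Ioo c d, ∃ D : ℝ × E n →L[ℝ] E (n + 1),
      HasStrictFDerivAt (fun p : ℝ × E n => φ p.1 (point 0 p.2)) D (t, ξ₀) := by
    intro t ht
    obtain ⟨D, hD⟩ := hφ.exists_hasStrictFDerivAt hb hc hd ht hx
    let J : ℝ × E n →L[ℝ] ℝ × E (n + 1) := (ContinuousLinearMap.id ℝ ℝ).prodMap (pointCLM n)
    exact ⟨D.comp J, HasStrictFDerivAt.comp (f := J) (t, ξ₀) hD J.hasStrictFDerivAt⟩
  obtain ⟨D, hD⟩ := key t₀ ht₀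
  obtain ⟨D₀, hD₀⟩ := key 0 ⟨hc, hd⟩
  refine ⟨D, hD, ?_⟩
  have hD₀1 : D₀ (1, 0) = b (point 0 ξ₀) := by
    have h1 : HasDerivAt (fun s : ℝ => (s, ξ₀)) ((1 : ℝ), (0 : E n)) 0 :=
      (hasDerivAt_id 0).prodMk (hasDerivAt_const 0 ξ₀)
    have h2 := hD₀.hasFDerivAt.comp_hasDerivAt 0 h1
    have h3 := hφ.hasDerivAt 0 (point 0 ξ₀)
    rw [hφ.zero] at h3
    exact h2.unique h3
  have hD₀2 : ∀ η, D₀ (0, η) = point 0 η := by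
    have h1 : HasFDerivAt (fun ξ : E n => ((0 : ℝ), ξ)) (ContinuousLinearMap.inr ℝ ℝ (E n)) ξ₀ :=
      hasFDerivAt_prodMk_right 0 ξ₀
    have h2 := HasFDerivAt.comp (f := fun ξ : E n => ((0 : ℝ), ξ)) ξ₀ hD₀.hasFDerivAt h1
    have h3 : HasFDerivAt (fun ξ : E n => φ 0 (point 0 ξ)) (pointCLM n) ξ₀ := by
      simp only [hφ.zero]
      exact (pointCLM n).hasFDerivAt
    intro η
    exact congrArg (fun A : E n →L[ℝ] E (n + 1) => A η) (h2.unique h3)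
  have hinj₀ : ∀ v, D₀ v = 0 → v = 0 := by
    rintro ⟨σ, η⟩ hv
    have e : ((σ, η) : ℝ × E n) = σ • ((1 : ℝ), (0 : E n)) + ((0 : ℝ), η) := by simp
    rw [e, map_add, map_smul, hD₀1, hD₀2] at hv
    have h0 : σ * b (point 0 ξ₀) 0 + 0 = 0 := congrArg (fun x : E (n + 1) => x 0) hv
    have hσ : σ = 0 := by simpa [(hin ξ₀).ne'] using h0
    rw [hσ, zero_smul, zero_add] at hv
    have hη : η = 0 := point_injective (hv.trans (map_zero (pointCLM n)).symm)
    rw [hσ, hη, Prod.mk_zero_zero]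
  -- the differential of the backward flow `φ (-t₀)` along the trajectory
  obtain ⟨B, hB⟩ := hφ.exists_hasStrictFDerivAt hb (x₀ := φ t₀ (point 0 ξ₀)) (c := c - t₀)
    (d := d - t₀) (t₀ := -t₀) (by linarith [ht₀.1]) (by linarith [ht₀.2])
    ⟨by linarith, by linarith⟩ (fun r hr => by
      rw [hφ.add hb]
      exact hx _ ⟨by linarith [hr.1], by linarith [hr.2]⟩)
  have h1 : HasFDerivAt (fun p : ℝ × E n => φ (-t₀) (φ p.1 (point 0 p.2)))
      (B.comp ((0 : ℝ × E n →L[ℝ] ℝ).prod D)) (t₀, ξ₀) :=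
    HasFDerivAt.comp (f := fun p : ℝ × E n => (-t₀, φ p.1 (point 0 p.2))) (t₀, ξ₀)
      hB.hasFDerivAt ((hasFDerivAt_const (-t₀) (t₀, ξ₀)).prodMk hD.hasFDerivAt)
  have h2 : HasFDerivAt (fun p : ℝ × E n => φ (-t₀) (φ p.1 (point 0 p.2))) D₀ (t₀, ξ₀) := by
    have h3 : HasFDerivAt (fun p : ℝ × E n => p + (-t₀, (0 : E n)))
        (ContinuousLinearMap.id ℝ (ℝ × E n)) (t₀, ξ₀) := (hasFDerivAt_id _).add_const _
    have h4 := HasFDerivAt.comp (f := fun p : ℝ × E n => p + (-t₀, (0 : E n)))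
      (g := fun p : ℝ × E n => φ p.1 (point 0 p.2)) (g' := D₀) (t₀, ξ₀)
      (by simpa using hD₀.hasFDerivAt) h3
    rw [ContinuousLinearMap.comp_id] at h4
    refine h4.congr_of_eventuallyEq (Eventually.of_forall fun p => ?_)
    simp [hφ.add hb, add_comm]
  have h5 := h1.unique h2
  refine (injective_iff_map_eq_zero D).2 fun v hv => hinj₀ v ?_
  rw [← h5]
  simp [hv, Prod.mk_zero_zero]

end Hyperplane

/-! ### Restriction of the flow to the domain of the vector field -/

section Restriction

variable {n : ℕ} {U : Set (E (n + 1))} {a b : E (n + 1) → E (n + 1)} {K : ℝ≥0}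
  {φ : ℝ → E (n + 1) → E (n + 1)}

/-- The infimum of the times `s` such that the trajectory of `(0, ξ)` stays in `U` during `[s, 0]`
(a void condition for `s > 0`). -/
noncomputable def exitTime (U : Set (E (n + 1))) (φ : ℝ → E (n + 1) → E (n + 1)) (ξ : E n) :
    EReal :=
  sInf ((fun s : ℝ => (s : EReal)) '' {s | ∀ r ∈ Set.Icc s 0, φ r (point 0 ξ) ∈ U})

theorem exitTime_lt_iff {ξ : E n} {t : EReal} : exitTime U φ ξ < t ↔
    ∃ s : ℝ, (s : EReal) < t ∧ ∀ r ∈ Set.Icc s 0, φ r (point 0 ξ) ∈ U := by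
  simp only [exitTime, sInf_lt_iff, Set.exists_mem_image, Set.mem_ofPred_eq]
  exact ⟨fun ⟨s, h1, h2⟩ => ⟨s, h2, h1⟩, fun ⟨s, h1, h2⟩ => ⟨s, h2, h1⟩⟩

theorem exitTime_neg (hU : IsOpen U) (hφ : IsGlobalFlow b φ) {ξ : E n} (hξ : point 0 ξ ∈ U) :
    exitTime U φ ξ < 0 := by
  have h : ∀ᶠ r in 𝓝 (0 : ℝ), φ r (point 0 ξ) ∈ U :=
    (hφ.continuous_left _).continuousAt.eventually_mem (hU.mem_nhds (by rwa [hφ.zero]))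
  obtain ⟨ε, hε, hball⟩ := Metric.eventually_nhds_iff_ball.1 h
  refine exitTime_lt_iff.2 ⟨-(ε / 2), by exact_mod_cast (by linarith : -(ε / 2) < 0),
    fun r hr => hball r ?_⟩
  rw [Metric.mem_ball, dist_zero_right, Real.norm_eq_abs, abs_of_nonpos hr.2]
  linarith [hr.1]

/-- Around any admissible time there is a compact interval containing `0` during which the
trajectory stays in `U`. -/
theorem exists_Icc_mem_of_exitTime_lt {ξ : E n} (h0 : exitTime U φ ξ < 0)
    (hpos : ∀ r, 0 < r → φ r (point 0 ξ) ∈ U) {t : ℝ} (ht : exitTime U φ ξ < t) :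
    ∃ c d, c < 0 ∧ 0 < d ∧ t ∈ Set.Ioo c d ∧ ∀ r ∈ Set.Icc c d, φ r (point 0 ξ) ∈ U := by
  obtain ⟨s, hs, hsU⟩ := exitTime_lt_iff.1 (lt_min ht h0)
  have hst : s < t := EReal.coe_lt_coe_iff.1 (hs.trans_le (min_le_left _ _))
  have hs0 : s < 0 := EReal.coe_lt_coe_iff.1 (hs.trans_le (min_le_right _ _))
  refine ⟨s, |t| + 1, hs0, by positivity, ⟨hst, by linarith [le_abs_self t]⟩, fun r hr => ?_⟩
  rcases le_or_gt r 0 with h | h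
  · exact hsU r ⟨hr.1, h⟩
  · exact hpos r h

theorem isOpen_flowDomain_exitTime (hU : IsOpen U) (hφ : IsGlobalFlow b φ)
    (hb : LipschitzWith K b) : IsOpen (flowDomain (n := n) (exitTime U φ) fun _ => ⊤) := by
  have e : flowDomain (n := n) (exitTime U φ) (fun _ => ⊤) =
      ⋃ s : ℝ, Set.Ioi s ×ˢ {ξ | ∀ r ∈ Set.Icc s 0, φ r (point 0 ξ) ∈ U} := by
    ext p
    simp [flowDomain, timeInterval, exitTime_lt_iff, EReal.coe_lt_top]
  rw [e]
  refine isOpen_iUnion fun s => isOpen_Ioi.prod (isOpen_iff_eventually.2 fun ξ hξ => ?_)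
  refine isCompact_Icc.eventually_forall_of_forall_eventually
    (P := fun ξ r => φ r (point 0 ξ) ∈ U) fun r hr => ?_
  have hc : Continuous fun z : E n × ℝ => φ z.2 (point 0 z.1) :=
    (hφ.continuous hb).comp
      (continuous_snd.prodMk ((pointCLM n).continuous.comp continuous_fst))
  exact hc.continuousAt.eventually_mem (hU.mem_nhds (hξ r hr))

/-- A solution with values in `U` is a piece of the trajectory of the extended field, and cannot
start before the exit time. -/
theorem IsSolution.eqOn_and_exitTime_le (hab : Set.EqOn a b U) (hφ : IsGlobalFlow b φ)
    (hb : LipschitzWith K b) {ξ : E n} {S T : EReal}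
    {y : ℝ → E (n + 1)} (hy : IsSolution U a (point 0 ξ) S T y) :
    Set.EqOn y (fun t => φ t (point 0 ξ)) (timeInterval S T) ∧ exitTime U φ ξ ≤ S := by
  have heq : Set.EqOn y (fun t => φ t (point 0 ξ)) (timeInterval S T) := by
    intro t ht
    obtain ⟨c, hSc, hc⟩ := EReal.lt_iff_exists_real_btwn.1 (lt_min ht.1 hy.left_neg)
    obtain ⟨d, hd, hdT⟩ := EReal.lt_iff_exists_real_btwn.1 (max_lt ht.2 hy.right_pos)
    have hct : c < t := EReal.coe_lt_coe_iff.1 (hc.trans_le (min_le_left _ _))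
    have hc0 : c < 0 := EReal.coe_lt_coe_iff.1 (hc.trans_le (min_le_right _ _))
    have htd : t < d := EReal.coe_lt_coe_iff.1 ((le_max_left _ _).trans_lt hd)
    have h0d : 0 < d := EReal.coe_lt_coe_iff.1 ((le_max_right _ _).trans_lt hd)
    refine hφ.eqOn hb hy.initial hc0 h0d (fun r hr => ?_) ⟨hct, htd⟩
    have hr' : r ∈ timeInterval S T :=
      ⟨hSc.trans (EReal.coe_lt_coe_iff.2 hr.1), (EReal.coe_lt_coe_iff.2 hr.2).trans hdT⟩
    rw [← hab (hy.mem r hr')]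
    exact hy.hasDerivAt r hr'
  refine ⟨heq, le_of_not_gt fun hlt => ?_⟩
  obtain ⟨c, hSc, hc⟩ := EReal.lt_iff_exists_real_btwn.1 hlt
  refine hc.not_ge (sInf_le ⟨c, fun r hr => ?_, rfl⟩)
  have hr' : r ∈ timeInterval S T :=
    ⟨hSc.trans_le (EReal.coe_le_coe_iff.2 hr.1),
      (EReal.coe_le_coe_iff.2 hr.2).trans_lt hy.right_pos⟩
  have h := heq hr'
  dsimp only at h
  rw [← h]
  exact hy.mem r hr'

/-! ### Quantitative estimates -/

/-- As long as the trajectory of `(0, ξ)` stays in `U`, its speed is at most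
`β + P * ‖x - (0, ξ)‖`, so in time `t` it moves by at most `β / P * (exp (P * t) - 1)`; this is
less than `L` for `t` smaller than the given logarithm. -/
theorem IsGlobalFlow.neg_mem_strip (hab : Set.EqOn a b U) (hφ : IsGlobalFlow b φ) {L : ℝ}
    (hL : 0 < L) (hLU : strip n L ⊆ U) {P : ℝ≥0} (hP : 0 < P) (hLip : LipschitzOnWith P a U)
    {β : ℝ} (hβ : 0 < β) {ξ : E n} (hbd : ‖a (point 0 ξ)‖ ≤ β) {t : ℝ} (ht0 : 0 ≤ t)
    (ht : t < 1 / (P : ℝ) * Real.log (1 + L * (P : ℝ) / β)) :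
    φ (-t) (point 0 ξ) ∈ strip n L := by
  have hP' : (0 : ℝ) < P := hP
  obtain ⟨t', htt', ht'⟩ := exists_between ht
  have ht'0 : 0 < t' := ht0.trans_lt htt'
  have hlog : P * t' < Real.log (1 + L * (P : ℝ) / β) := by
    rw [div_mul_eq_mul_div, one_mul, lt_div_iff₀ hP'] at ht'
    linarith
  have hexp' : Real.exp (P * t') < 1 + L * P / β := (Real.lt_log_iff_exp_lt (by positivity)).1 hlog
  have hexp1 : 1 < Real.exp (P * t') := Real.one_lt_exp_iff.2 (by positivity)
  -- a speed slightly above `β` that still leads to a displacement at most `L` at time `t' > t`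
  set γ := L * P / (Real.exp (P * t') - 1) with hγ
  have hβγ : β < γ := by
    rw [hγ, lt_div_iff₀ (by linarith)]
    have : Real.exp (P * t') - 1 < L * P / β := by linarith
    rw [lt_div_iff₀ hβ] at this
    linarith
  have hγ0 : 0 < γ := hβ.trans hβγ
  have hBL : ∀ r ≤ t, γ / P * (Real.exp (P * r) - 1) < L := by
    intro r hr
    have h1 : Real.exp (P * r) < Real.exp (P * t') :=
      Real.exp_lt_exp.2 (mul_lt_mul_of_pos_left (hr.trans_lt htt') hP')
    calc γ / P * (Real.exp (P * r) - 1) < γ / P * (Real.exp (P * t') - 1) := by gcongr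
      _ = L := by
        rw [hγ]
        have : Real.exp (P * t') - 1 ≠ 0 := by linarith
        field_simp
  have hmem : ∀ x : E (n + 1), ‖x - point 0 ξ‖ < L → x ∈ strip n L := by
    intro x hx
    have h1 : |x 0 - 0| ≤ ‖x - point 0 ξ‖ := PiLp.norm_apply_le (x - point 0 ξ) 0
    rw [sub_zero] at h1
    have := (abs_lt.1 (h1.trans_lt hx)).1
    exact this
  have hd : ∀ r, HasDerivAt (fun r => φ (-r) (point 0 ξ) - point 0 ξ)
      (-b (φ (-r) (point 0 ξ))) r := by
    intro r
    simpa [Function.comp_def] using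
      ((hφ.hasDerivAt (-r) (point 0 ξ)).scomp r (hasDerivAt_neg r)).sub_const (point 0 ξ)
  have hB : ∀ r : ℝ, HasDerivAt (fun r => γ / P * (Real.exp (P * r) - 1))
      (γ * Real.exp (P * r)) r := by
    intro r
    refine ((((hasDerivAt_id r).const_mul (P : ℝ)).exp.sub_const 1).const_mul
      (γ / P)).congr_deriv ?_
    simp only [id]
    field_simp
  have h := image_norm_le_of_norm_deriv_right_lt_deriv_boundary (a := 0) (b := t)
    (fun r _ => (hd r).continuousAt.continuousWithinAt)
    (fun r _ => (hd r).hasDerivWithinAt) (by simp [hφ.zero]) hB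
    (fun r hr hreq => by
      have hxU := hLU (hmem _ (hreq.trans_lt (hBL r hr.2.le)))
      have h1 := hLip.norm_sub_le hxU (hLU (point_mem_strip hL ξ))
      rw [norm_neg, ← hab hxU]
      calc ‖a (φ (-r) (point 0 ξ))‖
          ≤ ‖a (point 0 ξ)‖ + ‖a (φ (-r) (point 0 ξ)) - a (point 0 ξ)‖ :=
            norm_le_norm_add_norm_sub' _ _
        _ ≤ β + P * (γ / P * (Real.exp (P * r) - 1)) := by
            rw [← hreq]
            exact add_le_add hbd h1
        _ = β + γ * (Real.exp (P * r) - 1) := by field_simp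
        _ < γ * Real.exp (P * r) := by linarith)
    ⟨ht0, le_rfl⟩
  exact hmem _ (h.trans_lt (hBL t le_rfl))

/-- If the first component of the field is at least `α` on the strip, a point `x` of the strip
lies on a trajectory issued from the hyperplane, at time at least `2 * x₁ / α` when `x₁ < 0` and
at a nonnegative time otherwise. The slope `α / 2` leaves room for a strict comparison. -/
theorem IsGlobalFlow.exists_eq_of_mem_strip (hφ : IsGlobalFlow b φ)
    (hb : LipschitzWith K b) {L α : ℝ} (hL : 0 < L) (hα : 0 < α)
    (hge : ∀ z ∈ strip n L, α ≤ b z 0) {x : E (n + 1)} (hx : x ∈ strip n L) :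
    ∃ (s : ℝ) (ξ : E n), min 0 (2 * x 0 / α) ≤ s ∧ φ s (point 0 ξ) = x := by
  have fin : ∀ t : ℝ, φ t x 0 = 0 → ∃ ξ : E n, φ (-t) (point 0 ξ) = x := by
    intro t ht
    obtain ⟨ξ, hξ⟩ := exists_eq_point ht
    exact ⟨ξ, by rw [← hξ, hφ.neg_cancel hb]⟩
  have hcont : Continuous fun t => φ t x 0 :=
    (EuclideanSpace.proj (𝕜 := ℝ) (0 : Fin (n + 1))).continuous.comp (hφ.continuous_left x)
  have hxL : -L < x 0 := hx
  rcases le_total 0 (x 0) with h0 | h0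
  · -- backward in time, `x₁` decreases until it vanishes
    set T := 2 * x 0 / α with hT
    have hT0 : 0 ≤ T := by positivity
    have hd : ∀ r, HasDerivAt (fun r => φ (-r) x 0) (-b (φ (-r) x) 0) r := by
      intro r
      simpa [Function.comp_def] using
        (hφ.hasDerivAt_apply (-r) x 0).scomp r (hasDerivAt_neg r)
    have h := image_le_of_deriv_right_lt_deriv_boundary (a := 0) (b := T)
      (B := fun t => x 0 - t * (α / 2)) (B' := fun _ => -(α / 2))
      (fun r _ => (hd r).continuousAt.continuousWithinAt)
      (fun r _ => (hd r).hasDerivWithinAt) (by simp [hφ.zero])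
      (fun t => by simpa using ((hasDerivAt_id t).mul_const (α / 2)).const_sub (x 0))
      (fun r hr hreq => by
        have h1 : r * (α / 2) ≤ x 0 := by
          have := hr.2.le
          rw [hT, le_div_iff₀ hα] at this
          linarith
        have h2 := hge (φ (-r) x) (by change -L < φ (-r) x 0; linarith)
        linarith) ⟨hT0, le_rfl⟩
    have hTx : x 0 - T * (α / 2) = 0 := by rw [hT]; field_simp; ring
    have hcont' : ContinuousOn (fun t => φ (-t) x 0) (Set.Icc 0 T) :=
      (hcont.comp continuous_neg).continuousOn
    obtain ⟨t, ht, ht0⟩ := intermediate_value_Icc' hT0 hcont' (show (0 : ℝ) ∈ _ from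
      ⟨h.trans hTx.le, by simpa [hφ.zero] using h0⟩)
    obtain ⟨ξ, hξ⟩ := fin (-t) ht0
    exact ⟨t, ξ, (min_le_left _ _).trans ht.1, by rwa [neg_neg] at hξ⟩
  · -- forward in time, `x₁` increases until it vanishes
    set T := -(2 * x 0 / α) with hT
    have hT0 : 0 ≤ T := by
      rw [hT, neg_nonneg]
      exact div_nonpos_of_nonpos_of_nonneg (by linarith) hα.le
    have hd := fun r => (hφ.hasDerivAt_apply r x 0).neg
    have h := image_le_of_deriv_right_lt_deriv_boundary (a := 0) (b := T)
      (f := fun t => -φ t x 0) (f' := fun t => -b (φ t x) 0)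
      (B := fun t => -x 0 - t * (α / 2)) (B' := fun _ => -(α / 2))
      (fun r _ => (hd r).continuousAt.continuousWithinAt)
      (fun r _ => (hd r).hasDerivWithinAt) (by simp [hφ.zero])
      (fun t => by simpa using ((hasDerivAt_id t).mul_const (α / 2)).const_sub (-x 0))
      (fun r hr hreq => by
        have h1 : 0 ≤ r * (α / 2) := mul_nonneg hr.1 (by positivity)
        have h2 := hge (φ r x) (by change -L < φ r x 0; linarith)
        linarith) ⟨hT0, le_rfl⟩
    have hTx : -x 0 - T * (α / 2) = 0 := by rw [hT]; field_simp; ring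
    obtain ⟨t, ht, ht0⟩ := intermediate_value_Icc hT0 hcont.continuousOn (show (0 : ℝ) ∈ _ from
      ⟨by simpa [hφ.zero] using h0, by have := h.trans hTx.le; linarith⟩)
    obtain ⟨ξ, hξ⟩ := fin t ht0
    exact ⟨-t, ξ, (min_le_right _ _).trans (by linarith [ht.2]), hξ⟩

end Restriction

end CharFlow

/-! ### The characteristic flow -/

theorem mainTheorem2 (n : ℕ)
    (U : Set (CharFlow.E (n + 1))) (hU : IsOpen U)
    (a : CharFlow.E (n + 1) → CharFlow.E (n + 1)) (ha : ContDiffOn ℝ 1 a U)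
    (L : ℝ) (hL : 0 < L) (hLU : CharFlow.strip n L ⊆ U)
    (P : ℝ≥0) (hP : 0 < P) (hLip : LipschitzOnWith P a U)
    (α β : ℝ) (hα : 0 < α)
    (hin : ∀ ξ : CharFlow.E n, α ≤ a (CharFlow.point 0 ξ) 0)
    (hbd : ∀ ξ : CharFlow.E n, ‖a (CharFlow.point 0 ξ)‖ ≤ β) :
    ∃ (Tmin Tmax : CharFlow.E n → EReal) (x : CharFlow.E n → ℝ → CharFlow.E (n + 1)),
      -- (i) unique maximal solutions, global forward in time, and a `C¹` flow
      (∀ ξ : CharFlow.E n,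
        CharFlow.IsMaximalSolution U a (CharFlow.point 0 ξ) (Tmin ξ) (Tmax ξ) (x ξ) ∧
        (∀ (S T : EReal) (y : ℝ → CharFlow.E (n + 1)),
          CharFlow.IsMaximalSolution U a (CharFlow.point 0 ξ) S T y →
            S = Tmin ξ ∧ T = Tmax ξ ∧
              Set.EqOn y (x ξ) (CharFlow.timeInterval (Tmin ξ) (Tmax ξ))) ∧
        Tmin ξ < 0 ∧ Tmax ξ = ⊤ ∧
        ContDiffOn ℝ 1 (x ξ) (CharFlow.timeInterval (Tmin ξ) ⊤)) ∧
      IsOpen (CharFlow.flowDomain Tmin Tmax) ∧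
      ContDiffOn ℝ 1 (CharFlow.flow x) (CharFlow.flowDomain Tmin Tmax) ∧
      -- (ii) distinct characteristics do not intersect
      (∀ ξ η : CharFlow.E n, ξ ≠ η →
        Disjoint (x ξ '' CharFlow.timeInterval (Tmin ξ) (Tmax ξ))
          (x η '' CharFlow.timeInterval (Tmin η) (Tmax η))) ∧
      -- (iii) and (iv), for the explicit value of `ℓ`
      (∃ l : ℝ, l = 1 / (P : ℝ) * Real.log (1 + L * (P : ℝ) / β) ∧ 0 < l ∧
        CharFlow.flowStrip n l ⊆ CharFlow.flowDomain Tmin Tmax ∧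
        CharFlow.IsC1DiffeoOn (CharFlow.flow x) (CharFlow.flowStrip n l) ∧
        CharFlow.flow x '' CharFlow.flowStrip n l ⊆ U ∧
        ((∀ z ∈ U, α ≤ a z 0) →
          ∃ δ : ℝ, 0 < δ ∧
            CharFlow.strip n δ ⊆ CharFlow.flow x '' CharFlow.flowStrip n l)) := by
  have hstrip : ∀ ξ : CharFlow.E n, CharFlow.point 0 ξ ∈ U :=
    fun ξ => hLU (CharFlow.point_mem_strip hL ξ)
  have hβ : 0 < β := hα.trans_le <| (hin 0).trans <|
    ((le_abs_self _).trans (PiLp.norm_apply_le (a (CharFlow.point 0 0)) 0)).trans (hbd 0)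
  obtain ⟨b, hb, hab⟩ := hLip.extend_finite_dimension
  obtain ⟨φ, hφ⟩ := CharFlow.exists_isGlobalFlow hb
  have hbin : ∀ ξ : CharFlow.E n, 0 < b (CharFlow.point 0 ξ) 0 := fun ξ => by
    rw [← hab (hstrip ξ)]
    exact hα.trans_le (hin ξ)
  have hbC : ∀ z ∈ U, ContDiffAt ℝ 1 b z := fun z hz =>
    (ha.contDiffAt (hU.mem_nhds hz)).congr_of_eventuallyEq
      (Filter.eventually_of_mem (hU.mem_nhds hz) fun _ hw => (hab hw).symm)
  have hpos : ∀ (ξ : CharFlow.E n) (r : ℝ), 0 < r → φ r (CharFlow.point 0 ξ) ∈ U :=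
    fun ξ r hr => hLU ((neg_neg_of_pos hL).trans (hφ.apply_zero_pos hbin ξ hr))
  have hneg : ∀ ξ, CharFlow.exitTime U φ ξ < 0 :=
    fun ξ => CharFlow.exitTime_neg hU hφ (hstrip ξ)
  have hwin := fun ξ (t : ℝ) (ht : CharFlow.exitTime U φ ξ < t) =>
    CharFlow.exists_Icc_mem_of_exitTime_lt (hneg ξ) (hpos ξ) ht
  have hmem : ∀ ξ, ∀ t ∈ CharFlow.timeInterval (CharFlow.exitTime U φ ξ) ⊤,
      φ t (CharFlow.point 0 ξ) ∈ U := fun ξ t ht => by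
    obtain ⟨c, d, -, -, htcd, hcd⟩ := hwin ξ t ht.1
    exact hcd t (Set.Ioo_subset_Icc_self htcd)
  have hsol : ∀ ξ, CharFlow.IsSolution U a (CharFlow.point 0 ξ) (CharFlow.exitTime U φ ξ) ⊤
      (fun t => φ t (CharFlow.point 0 ξ)) := fun ξ =>
    ⟨hneg ξ, EReal.zero_lt_top, hφ.zero _, hmem ξ, fun t ht => by
      rw [hab (hmem ξ t ht)]
      exact hφ.hasDerivAt t _⟩
  have hopen := CharFlow.isOpen_flowDomain_exitTime hU hφ hb
  have hdiff : ∀ p ∈ CharFlow.flowDomain (CharFlow.exitTime U φ) (fun _ => ⊤),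
      ∃ D : ℝ × CharFlow.E n →L[ℝ] CharFlow.E (n + 1),
        HasStrictFDerivAt (CharFlow.flow fun ξ t => φ t (CharFlow.point 0 ξ)) D p ∧
          Function.Injective D := by
    rintro ⟨t, ξ⟩ hp
    obtain ⟨c, d, hc, hd, htcd, hcd⟩ := hwin ξ t hp.1
    exact hφ.exists_hasStrictFDerivAt_injective hb hbin hc hd htcd fun r hr => hbC _ (hcd r hr)
  have hC1 : ContDiffOn ℝ 1 (CharFlow.flow fun ξ t => φ t (CharFlow.point 0 ξ))
      (CharFlow.flowDomain (CharFlow.exitTime U φ) fun _ => ⊤) :=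
    CharFlow.contDiffOn_one_of_hasStrictFDerivAt hopen
      fun p hp => (hdiff p hp).imp fun _ h => h.1
  have hP' : (0 : ℝ) < P := hP
  set l := 1 / (P : ℝ) * Real.log (1 + L * (P : ℝ) / β) with hl
  have hl0 : 0 < l := mul_pos (by positivity) <| Real.log_pos <| by
    have : 0 < L * (P : ℝ) / β := by positivity
    linarith
  have hsub : CharFlow.flowStrip n l ⊆
      CharFlow.flowDomain (CharFlow.exitTime U φ) fun _ => ⊤ := by
    rintro ⟨t, ξ⟩ (ht : -l < t)
    obtain ⟨s, hls, hst⟩ := exists_between ht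
    refine ⟨CharFlow.exitTime_lt_iff.2 ⟨s, EReal.coe_lt_coe_iff.2 hst, fun r hr => hLU ?_⟩,
      EReal.coe_lt_top t⟩
    rw [← neg_neg r]
    exact hφ.neg_mem_strip hab hL hLU hP hLip hβ (hbd ξ) (neg_nonneg.2 hr.2)
      (by linarith [hr.1])
  refine ⟨CharFlow.exitTime U φ, fun _ => ⊤, fun ξ t => φ t (CharFlow.point 0 ξ), fun ξ => ⟨?_, ?_,
    hneg ξ, rfl, ?_⟩, hopen, hC1, ?_, l, rfl, hl0, hsub, ?_, ?_, ?_⟩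
  · refine ⟨hsol ξ, fun S' T' y hy hS hT _ => ⟨?_, top_le_iff.1 hT⟩⟩
    exact le_antisymm hS (hy.eqOn_and_exitTime_le hab hφ hb).2
  · intro S T y hy
    obtain ⟨h1, h2⟩ := hy.isSolution.eqOn_and_exitTime_le hab hφ hb
    obtain ⟨rfl, rfl⟩ := hy.maximal _ _ _ (hsol ξ) h2 le_top h1.symm
    exact ⟨rfl, rfl, h1⟩
  · exact hC1.comp (f := fun t : ℝ => (t, ξ)) (contDiff_id.prodMk contDiff_const).contDiffOn
      fun t ht => ht
  · intro ξ η hne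
    rw [Set.disjoint_left]
    rintro _ ⟨s, -, rfl⟩ ⟨t, -, h⟩
    exact hne (hφ.eq_and_eq_of_eq hb hbin h).2.symm
  · refine CharFlow.isC1DiffeoOn_of_injOn (by simp [add_comm])
      (isOpen_lt continuous_const continuous_fst) (hC1.mono hsub)
      (fun p _ q _ h => ?_) fun p hp => ?_
    · obtain ⟨h1, h2⟩ := hφ.eq_and_eq_of_eq hb hbin h
      exact Prod.ext h1 h2
    · obtain ⟨D, hD, hDi⟩ := hdiff p (hsub hp)
      rwa [hD.hasFDerivAt.fderiv]
  · rintro _ ⟨p, hp, rfl⟩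
    exact hmem p.2 p.1 (hsub hp)
  · intro hge
    -- within distance `α * l / 2` of the hyperplane, it is reached in time less than `l`;
    -- the bound `L` keeps the trajectory in the strip, where `a₁ ≥ α` is known
    refine ⟨min L (α * l / 2), lt_min hL (by positivity),
      fun x (hx : -min L (α * l / 2) < x 0) => ?_⟩
    obtain ⟨s, ξ, hs, rfl⟩ := hφ.exists_eq_of_mem_strip hb hL hα
      (fun z hz => by rw [← hab (hLU hz)]; exact hge z (hLU hz))
      (show x ∈ CharFlow.strip n L from (neg_le_neg (min_le_left _ _)).trans_lt hx)
    refine ⟨(s, ξ), show -l < s from lt_of_lt_of_le (lt_min (by linarith) ?_) hs, rfl⟩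
    have h := (neg_le_neg (min_le_right L (α * l / 2))).trans_lt hx
    rw [lt_div_iff₀ hα]
    linarith
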